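/- All graphs are finite, undirected and simple. For a graph $F$, let $\alpha(F)$ be its independence number and $\mu(F)$ its matching number; $F$ is König--Egerváry if $\alpha(F)+\mu(F)=|V(F)|$, and almost bipartite if it has exactly one odd cycle. Let $D(F)$ be the set of vertices missed by some maximum matching of $F$, $A(F)$ the set of vertices outside $D(F)$ that have a neighbour in $D(F)$, and $C(F)=V(F)\setminus(D(F)\cup A(F))$. For a matching $M$ of $F$, an $M$-blossom is a cycle of length $2m+1$ with $m$ edges in $M$; its base is the vertex of the cycle that is not covered by these $m$ edges. An $M$-stem of the blossom is an $M$-alternating path of even (possibly zero) length from the base to a vertex not saturated by $M$, meeting the blossom only in the base. A blossom together with a stem is an $M$-flower. For an odd cycle $O$ of $F$, the set $R(O)$ is the union of the vertex sets of all $M$-flowers of $F$ with blossom $O$, over all maximum matchings $M$ of $F$. Let $B,G_1,\dots,G_k$ be pairwise disjoint graphs such that $B$ is bipartite (possibly empty) and each $G_i$ is an almost bipartite non-König--Egerváry graph whose unique odd cycle $O_i$ satisfies $R(O_i)=V(G_i)$. Let $G$ be obtained from the disjoint union $B\cup G_1\cup\dots\cup G_k$ by adding edges between vertices belonging to different graphs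 in such a way that every vertex of $B$ with a neighbour outside $V(B)$ lies in $A(B)\cup C(B)$, and, for each $i$, every vertex of $G_i$ with a neighbour outside $V(G_i)$ lies in $A(G_i)$. Such a graph is called a BAB-graph and is denoted by $G=(B,G_1,\dots,G_k)$. A Sachs subgraph of $G$ is a spanning subgraph of $G$ each of whose connected components is a $K_2$ or a cycle. \textbf{Theorem.} Let $G=(B,G_1,\dots,G_k)$ be a BAB-graph and let $H$ be a Sachs subgraph of $G$. If $H'$ is a connected component of $H$, then either $V(H')\subseteq V(B)$ or $V(H')\subseteq V(G_i)$ for some $i\in\{1,\dots,k\}$. -/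

import Mathlib

namespace BABGraph

open SimpleGraph

section Matchings

/-- `M` is a matching of `G` with the largest possible number of edges.
The vertices saturated by `M` are those in `M.verts`. -/
def IsMaximumMatching {V : Type*} {G : SimpleGraph V} (M : G.Subgraph) : Prop :=
  M.IsMatching ∧ ∀ N : G.Subgraph, N.IsMatching → N.edgeSet.ncard ≤ M.edgeSet.ncard

/-- The matching number `μ(G)`. -/
noncomputable def matchingNumber {V : Type*} (G : SimpleGraph V) : ℕ :=
  sSup {n : ℕ | ∃ M : G.Subgraph, M.IsMatching ∧ M.edgeSet.ncard = n}

/-- König–Egerváry graphs: `α(G) + μ(G) = |V(G)|`. -/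
def IsKonigEgervary {V : Type*} (G : SimpleGraph V) : Prop :=
  G.indepNum + matchingNumber G = Nat.card V

end Matchings

section GallaiEdmonds

/-- Gallai–Edmonds set `D(G)`: vertices missed by some maximum matching. -/
def geD {V : Type*} (G : SimpleGraph V) : Set V :=
  {v | ∃ M : G.Subgraph, IsMaximumMatching M ∧ v ∉ M.verts}

/-- Gallai–Edmonds set `A(G)`: vertices outside `D(G)` with a neighbour in `D(G)`. -/
def geA {V : Type*} (G : SimpleGraph V) : Set V :=
  {v | v ∉ geD G ∧ ∃ u ∈ geD G, G.Adj v u}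

/-- Gallai–Edmonds set `C(G)`: all remaining vertices. -/
def geC {V : Type*} (G : SimpleGraph V) : Set V :=
  (geD G ∪ geA G)ᶜ

end GallaiEdmonds

section OddCycles

/-- The subgraph `C` of `G` is a cycle of odd length. -/
def IsOddCycle {V : Type*} {G : SimpleGraph V} (C : G.Subgraph) : Prop :=
  ∃ (v : V) (c : G.Walk v v), c.IsCycle ∧ Odd c.length ∧ c.toSubgraph = C

/-- A graph is almost bipartite if it has exactly one odd cycle
(cycles being counted as subgraphs). -/
def IsAlmostBipartite {V : Type*} (G : SimpleGraph V) : Prop :=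
  ∃! C : G.Subgraph, IsOddCycle C

/-- A walk is `M`-alternating if of any two consecutive edges exactly one belongs to `M`. -/
def IsAlternatingWalk {V : Type*} {G : SimpleGraph V} (M : G.Subgraph) {u v : V}
    (p : G.Walk u v) : Prop :=
  p.edges.IsChain fun e f => e ∈ M.edgeSet ↔ f ∉ M.edgeSet

/-- `c` is an `M`-blossom with base `b`: a cycle of length `2m + 1` with `m` edges in `M`,
where `b` is the vertex of the cycle not covered by these `m` edges. -/
structure IsBlossom {V : Type*} {G : SimpleGraph V} (M : G.Subgraph) {b : V}
    (c : G.Walk b b) : Prop where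
  isCycle : c.IsCycle
  length_eq : c.length = 2 * {e | e ∈ c.edges ∧ e ∈ M.edgeSet}.ncard + 1
  base : ∀ e ∈ c.edges, b ∈ e → e ∉ M.edgeSet

/-- An `M`-flower: an `M`-blossom `c` with base `b`, and an `M`-stem `p`, i.e. an `M`-alternating
path of even (possibly zero) length from `b` to a vertex `r` not saturated by `M`,
which meets the blossom only in `b`. -/
structure IsFlower {V : Type*} {G : SimpleGraph V} (M : G.Subgraph) {b r : V}
    (c : G.Walk b b) (p : G.Walk b r) : Prop where
  blossom : IsBlossom M c
  isPath : p.IsPath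
  alternating : IsAlternatingWalk M p
  even_length : Even p.length
  root : r ∉ M.verts
  inter : ∀ v, v ∈ c.support → v ∈ p.support → v = b

/-- The reach set `R(C)`: the union of the vertex sets of all `M`-flowers with blossom `C`,
over all maximum matchings `M`. -/
def reachSet {V : Type*} {G : SimpleGraph V} (C : G.Subgraph) : Set V :=
  {v | ∃ M : G.Subgraph, IsMaximumMatching M ∧
    ∃ (b r : V) (c : G.Walk b b) (p : G.Walk b r),
      IsFlower M c p ∧ c.toSubgraph = C ∧ (v ∈ c.support ∨ v ∈ p.support)}

end OddCycles

section BAB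

/-- The vertices of `S` having a neighbour outside `S`. -/
def boundary {V : Type*} (G : SimpleGraph V) (S : Set V) : Set V :=
  {v | v ∈ S ∧ ∃ w, w ∉ S ∧ G.Adj v w}

/-- `G` is the BAB-graph `(B, G₁, …, Gₖ)`, where `B` and the `Gᵢ` are the subgraphs of `G`
induced by the vertex sets `VB` and `VG i`. As edges are only added between different pieces,
`G` arises from the disjoint union of the pieces exactly when the pieces are the subgraphs
induced by the parts of a partition of the vertex set (parts of which `VB` may be empty). -/
structure IsBAB {V : Type*} (G : SimpleGraph V) {k : ℕ} (VB : Set V) (VG : Fin k → Set V) :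
    Prop where
  disjoint_base : ∀ i, Disjoint VB (VG i)
  disjoint_parts : ∀ i j, i ≠ j → Disjoint (VG i) (VG j)
  cover : VB ∪ ⋃ i, VG i = Set.univ
  bipartite : (G.induce VB).IsBipartite
  almostBipartite : ∀ i, IsAlmostBipartite (G.induce (VG i))
  not_konigEgervary : ∀ i, ¬ IsKonigEgervary (G.induce (VG i))
  reach : ∀ i, ∀ C : (G.induce (VG i)).Subgraph, IsOddCycle C → reachSet C = Set.univ
  boundary_base : boundary G VB ⊆ Subtype.val '' (geA (G.induce VB) ∪ geC (G.induce VB))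
  boundary_parts : ∀ i, boundary G (VG i) ⊆ Subtype.val '' geA (G.induce (VG i))

/-- A Sachs subgraph of `G`: a spanning subgraph, i.e. a graph `H ≤ G` on all vertices of `G`,
each of whose connected components is a `K₂` or a cycle. -/
def IsSachs {V : Type*} (G H : SimpleGraph V) : Prop :=
  H ≤ G ∧ ∀ K : H.ConnectedComponent,
    Nonempty (K.toSimpleGraph ≃g completeGraph (Fin 2)) ∨
      ∃ n : ℕ, 3 ≤ n ∧ Nonempty (K.toSimpleGraph ≃g cycleGraph n)

end BAB

end BABGraph

namespace BABGraph

open SimpleGraph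

/-! ### Parity of walks in a graph with a unique odd cycle. -/

section Parity

variable {V : Type*} {G : SimpleGraph V}

/-! Inside each part `G_i` with odd cycle `O` there is a set `I`, disjoint from a set `Y ⊇ A(G_i)`,
with all its neighbours in `Y` and `|Y| ≤ |I|` (`exists_independent_set`). Boundary vertices lie in
`A(G_i)`, so even in `G` the neighbours of `I` stay in `Y`. Giving each edge of a Sachs subgraph the
weight 1/degree makes it a fractional perfect matching; the weight leaving `I` fills `Y` completely,
so `Y` has Sachs edges only to `I`, and none leaves `G_i` (`IsSachs.mem_of_adj`).

To find `I` and `Y`, sort vertices by the parity of walks from `O` that avoid the edges of `O`.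
Uniqueness of `O` makes this parity well defined (`even_of_avoids`), and the flowers give every
vertex a parity. `Y` is the set of odd vertices and `I` the set of even vertices off `O`. Shifting
matchings along stems and around `O` shows that even vertices are in `D(G_i)`, whence `A(G_i) ⊆ Y`.

For `|Y| ≤ |I|`, contract `O` and apply Hall's theorem with deficiency: a set `T ⊆ Y` of maximum
deficiency is the only obstacle to saturating `Y` (`exists_tight_set`). No stem can enter `T`, but
stems cover `Y`; so `T` is empty, and a maximum matching near-perfect on `O` injects `Y` into `I`.
-/

theorem edge_notMem_edges_of_even_path {u v : V} (h : G.Adj u v) (p : G.Walk v u)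
    (hp : p.IsPath) (he : Even p.length) : s(u, v) ∉ p.edges := by
  cases p with
  | nil => simp
  | @cons _ x _ h' q =>
    rw [Walk.cons_isPath_iff] at hp
    intro hmem
    rw [Walk.edges_cons, List.mem_cons] at hmem
    rcases hmem with hmem | hmem
    · have hx : x = u := by
        rcases Sym2.eq_iff.1 hmem with ⟨h1, -⟩ | ⟨h1, -⟩
        · exact absurd h1 h.ne
        · exact h1.symm
      subst hx
      have : q = .nil := (Walk.isPath_iff_nil.1 hp.1).eq_nil
      subst this
      simp at he
    · exact hp.2 (q.snd_mem_support_of_mem_edges hmem)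

/-- When the new first vertex `u` already lies on the path, the segment up to `u` either is even,
and closes with the new edge to an odd cycle, or is odd, and is cut off together with that edge
without changing parity. -/
theorem exists_odd_cycle_or_path {u v : V} (p : G.Walk u v) :
    (∃ (w : V) (c : G.Walk w w), c.IsCycle ∧ Odd c.length) ∨
      ∃ q : G.Walk u v, q.IsPath ∧ (Even q.length ↔ Even p.length) := by
  classical
  induction p with
  | nil => exact .inr ⟨.nil, by simp, Iff.rfl⟩
  | @cons u x v h p ih =>
    rcases ih with ih | ⟨q, hq, hpar⟩
    · exact .inl ih
    by_cases hu : u ∈ q.support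
    · have hsum : (q.takeUntil u hu).length + (q.dropUntil u hu).length = q.length := by
        rw [← Walk.length_append, Walk.take_spec]
      by_cases hev : Even (q.takeUntil u hu).length
      · refine .inl ⟨u, .cons h (q.takeUntil u hu), ?_, ?_⟩
        · rw [Walk.cons_isCycle_iff]
          exact ⟨hq.takeUntil hu, edge_notMem_edges_of_even_path h _ (hq.takeUntil hu) hev⟩
        · rw [Walk.length_cons]; exact hev.add_one
      · refine .inr ⟨q.dropUntil u hu, hq.dropUntil hu, ?_⟩
        rw [Walk.length_cons]
        grind
    · refine .inr ⟨.cons h q, hq.cons hu, ?_⟩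
      simp only [Walk.length_cons]
      grind

/-- A closed walk of odd length forces an odd cycle. -/
theorem exists_odd_cycle_of_odd_loop {u : V} (p : G.Walk u u) (hp : Odd p.length) :
    ∃ (w : V) (c : G.Walk w w), c.IsCycle ∧ Odd c.length := by
  rcases exists_odd_cycle_or_path p with h | ⟨q, hq, hpar⟩
  · exact h
  · rw [(Walk.isPath_iff_nil.1 hq).eq_nil] at hpar
    simp at hpar
    exact absurd hpar (Nat.not_even_iff_odd.2 hp)

/-- If `O` is the only odd cycle, a closed walk avoiding an edge of `O` is even. -/
theorem even_loop_of_avoids {O : G.Subgraph} (hO : ∀ C : G.Subgraph, IsOddCycle C → C = O)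
    {e : Sym2 V} (he : e ∈ O.edgeSet) {u : V} (p : G.Walk u u) (hp : e ∉ p.edges) :
    Even p.length := by
  by_contra hodd
  rw [Nat.not_even_iff_odd] at hodd
  have hp' : ∀ e' ∈ p.edges, e' ∉ ({e} : Set (Sym2 V)) := by
    rintro e' he' rfl; exact hp he'
  -- Deleting `e` leaves the closed walk intact, so the smaller graph has an odd cycle; it misses
  -- `e` and hence is not `O`.
  obtain ⟨w, c, hc, hcl⟩ := exists_odd_cycle_of_odd_loop (p.toDeleteEdges {e} hp')
    (by rwa [Walk.length_transfer])
  have hle : G.deleteEdges {e} ≤ G := deleteEdges_le _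
  have hOC := hO (c.mapLe hle).toSubgraph ⟨w, c.mapLe hle, hc.mapLe hle, by simpa using hcl, rfl⟩
  rw [← hOC, Walk.mem_edges_toSubgraph, Walk.edges_mapLe_eq_edges] at he
  have := c.edges_subset_edgeSet he
  simp at this

/-- If `O` is the only odd cycle, walks between vertices of `O` avoiding the edges of `O`
are even. -/
theorem even_of_avoids {O : G.Subgraph} (hodd : IsOddCycle O)
    (hO : ∀ C : G.Subgraph, IsOddCycle C → C = O)
    {s t : V} (hs : s ∈ O.verts) (ht : t ∈ O.verts) (w : G.Walk s t)
    (hw : ∀ e ∈ w.edges, e ∉ O.edgeSet) : Even w.length := by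
  classical
  obtain ⟨v, c, hc, hcl, rfl⟩ := hodd
  rw [Walk.mem_verts_toSubgraph] at hs ht
  obtain ⟨d, hd, hdl, hde⟩ : ∃ d : G.Walk s s, d.IsCycle ∧ Odd d.length ∧
      d.toSubgraph = c.toSubgraph :=
    ⟨c.rotate s hs, hc.rotate hs, by rwa [Walk.length_rotate], by simp⟩
  rw [← hde] at hO hw
  have htd : t ∈ d.support := by
    rw [← Walk.mem_verts_toSubgraph, hde, Walk.mem_verts_toSubgraph]; exact ht
  simp only [Walk.mem_edges_toSubgraph] at hw
  have hne : ∃ e, e ∈ d.edges := by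
    have : d.edges ≠ [] := by
      intro h
      have := d.length_edges
      rw [h] at this
      simp at this
      rw [← this] at hdl; simp at hdl
    exact List.exists_mem_of_ne_nil _ this
  by_cases hst : s = t
  · subst hst
    obtain ⟨e, he⟩ := hne
    exact even_loop_of_avoids hO (by rwa [Walk.mem_edges_toSubgraph]) w fun h => hw e h he
  have hspec := Walk.take_spec d htd
  set a := d.takeUntil t htd
  set b := d.dropUntil t htd
  have hdisj : ∀ e ∈ a.edges, e ∉ b.edges := by
    have := hd.1.1.edges_nodup
    rw [← hspec, Walk.edges_append] at this
    exact fun e h1 h2 => (List.nodup_append.1 this).2.2 e h1 e h2 rfl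
  have hmem : ∀ e, e ∈ d.edges ↔ e ∈ a.edges ∨ e ∈ b.edges := by
    intro e; rw [← hspec, Walk.edges_append, List.mem_append]
  have hlen : d.length = a.length + b.length := by rw [← hspec, Walk.length_append]
  obtain ⟨x, ha⟩ : ∃ e, e ∈ a.edges := by
    cases h : a with
    | nil => exact absurd rfl hst
    | cons h q => exact ⟨_, by rw [Walk.edges_cons]; exact List.mem_cons_self⟩
  obtain ⟨y, hb⟩ : ∃ e, e ∈ b.edges := by
    cases h : b with
    | nil => exact absurd rfl hst
    | cons h q => exact ⟨_, by rw [Walk.edges_cons]; exact List.mem_cons_self⟩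
  -- Closing `w` by either arc of `O` misses an edge of the other arc, so both closed walks are
  -- even. Then the arcs have equal parity, contradicting that `O` is odd: distinct vertices of `O`
  -- are never joined off its edges.
  have h1 := even_loop_of_avoids hO (e := y)
    (by rw [Walk.mem_edges_toSubgraph, hmem]; exact .inr hb) (w.append a.reverse) (by
      simp only [Walk.edges_append, Walk.edges_reverse, List.mem_append, List.mem_reverse]
      rintro (h | h)
      · exact hw y h ((hmem y).2 (.inr hb))
      · exact hdisj y h hb)
  have h2 := even_loop_of_avoids hO (e := x)
    (by rw [Walk.mem_edges_toSubgraph, hmem]; exact .inl ha) (w.append b) (by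
      simp only [Walk.edges_append, List.mem_append]
      rintro (h | h)
      · exact hw x h ((hmem x).2 (.inl ha))
      · exact hdisj x ha h)
  simp only [Walk.length_append, Walk.length_reverse] at h1 h2
  grind

end Parity

/-! ### Matchings as involutions, and exchanges along stems and odd cycles. -/

section Involutions

variable {V : Type*} {G : SimpleGraph V}

/-- A matching of `G` encoded as the involution exchanging the ends of its edges. -/
structure IsInvMatching (G : SimpleGraph V) (σ : V → V) : Prop where
  invol : ∀ v, σ (σ v) = v
  adj : ∀ v, σ v ≠ v → G.Adj v (σ v)

/-- The vertices moved by `σ`. -/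
def movedSet (σ : V → V) : Set V := {v | σ v ≠ v}

/-- A maximum matching encoded as an involution. -/
def IsMaxInvMatching (G : SimpleGraph V) (σ : V → V) : Prop :=
  IsInvMatching G σ ∧ ∀ τ, IsInvMatching G τ → (movedSet τ).ncard ≤ (movedSet σ).ncard

theorem IsInvMatching.injective {σ : V → V} (h : IsInvMatching G σ) : Function.Injective σ :=
  Function.LeftInverse.injective h.invol

theorem two_mul_ncard_image_edges [Finite V] {σ : V → V} (hinv : ∀ v, σ (σ v) = v) (W : Set V)
    (hW : ∀ v ∈ W, σ v ∈ W ∧ σ v ≠ v) :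
    2 * ((fun v => s(v, σ v)) '' W).ncard = W.ncard := by
  classical
  have := Fintype.ofFinite V
  rw [Set.ncard_eq_toFinset_card' W, Set.ncard_eq_toFinset_card', Set.toFinset_image]
  rw [Finset.card_eq_sum_card_image (fun v => s(v, σ v)) W.toFinset]
  rw [Finset.sum_const_nat (m := 2), mul_comm]
  intro e he
  obtain ⟨v, hv, rfl⟩ := Finset.mem_image.1 he
  rw [Set.mem_toFinset] at hv
  have : W.toFinset.filter (fun a => s(a, σ a) = s(v, σ v)) = {v, σ v} := by
    ext a
    simp only [Finset.mem_filter, Set.mem_toFinset, Finset.mem_insert, Finset.mem_singleton,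
      Sym2.eq_iff]
    constructor
    · rintro ⟨-, ⟨h, -⟩ | ⟨h, -⟩⟩
      · exact .inl h
      · exact .inr h
    · rintro (rfl | rfl)
      · exact ⟨hv, .inl ⟨rfl, rfl⟩⟩
      · exact ⟨(hW v hv).1, .inr ⟨rfl, hinv v⟩⟩
  rw [this, Finset.card_pair (hW v hv).2.symm]

theorem exists_invMatching {M : G.Subgraph} (hM : M.IsMatching) :
    ∃ σ, IsInvMatching G σ ∧ ∀ u v, M.Adj u v ↔ σ u = v ∧ u ≠ v := by
  classical
  have hex : ∀ v, ∃ w, (v ∈ M.verts → M.Adj v w) ∧ (v ∉ M.verts → w = v) := by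
    intro v
    by_cases hv : v ∈ M.verts
    · obtain ⟨w, hw, -⟩ := hM hv
      exact ⟨w, fun _ => hw, fun h => absurd hv h⟩
    · exact ⟨v, fun h => absurd h hv, fun _ => rfl⟩
  choose σ h1 h2 using hex
  have key : ∀ u v, M.Adj u v ↔ σ u = v ∧ u ≠ v := by
    intro u v
    constructor
    · intro h
      exact ⟨hM.eq_of_adj_left (h1 u (M.edge_vert h)) h, h.ne⟩
    · rintro ⟨rfl, hne⟩
      by_cases hu : u ∈ M.verts
      · exact h1 u hu
      · exact absurd (h2 u hu).symm hne
  refine ⟨σ, ⟨fun v => ?_, fun v hv => ?_⟩, key⟩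
  · by_cases hv : σ v = v
    · rw [hv, hv]
    · exact ((key _ _).1 ((key v (σ v)).2 ⟨rfl, Ne.symm hv⟩).symm).1
  · exact M.adj_sub ((key v (σ v)).2 ⟨rfl, Ne.symm hv⟩)

/-- The subgraph of a matching encoded as an involution. -/
def IsInvMatching.toSubgraph {σ : V → V} (h : IsInvMatching G σ) : G.Subgraph where
  verts := movedSet σ
  Adj u v := σ u = v ∧ u ≠ v
  adj_sub := by rintro u v ⟨rfl, hne⟩; exact h.adj u hne.symm
  edge_vert := by rintro u v ⟨rfl, hne⟩; exact hne.symm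
  symm := ⟨by rintro u v ⟨rfl, hne⟩; exact ⟨h.invol u, hne.symm⟩⟩

theorem IsInvMatching.isMatching_toSubgraph {σ : V → V} (h : IsInvMatching G σ) :
    h.toSubgraph.IsMatching :=
  fun v hv => ⟨σ v, ⟨rfl, Ne.symm hv⟩, fun _ hw => hw.1.symm⟩

theorem two_mul_ncard_edgeSet [Finite V] {M : G.Subgraph} {σ : V → V} (h : IsInvMatching G σ)
    (hMσ : ∀ u v, M.Adj u v ↔ σ u = v ∧ u ≠ v) :
    2 * M.edgeSet.ncard = (movedSet σ).ncard := by
  rw [← two_mul_ncard_image_edges h.invol (movedSet σ)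
    (fun v hv => ⟨by rw [movedSet, Set.mem_ofPred_eq, h.invol]; exact Ne.symm hv, hv⟩)]
  congr 2
  ext e
  induction e with
  | h u v =>
    rw [Subgraph.mem_edgeSet, hMσ]
    constructor
    · rintro ⟨rfl, hne⟩
      exact ⟨u, hne.symm, rfl⟩
    · rintro ⟨a, ha, hab⟩
      rcases Sym2.eq_iff.1 hab with ⟨rfl, rfl⟩ | ⟨rfl, rfl⟩
      · exact ⟨rfl, Ne.symm ha⟩
      · exact ⟨h.invol a, ha⟩

theorem IsMaximumMatching.exists_isMaxInvMatching [Finite V] {M : G.Subgraph}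
    (hM : IsMaximumMatching M) :
    ∃ σ, IsMaxInvMatching G σ ∧ ∀ u v, M.Adj u v ↔ σ u = v ∧ u ≠ v := by
  obtain ⟨σ, hσ, hMσ⟩ := exists_invMatching hM.1
  refine ⟨σ, ⟨hσ, fun τ hτ => ?_⟩, hMσ⟩
  rw [← two_mul_ncard_edgeSet hσ hMσ,
    ← two_mul_ncard_edgeSet (M := hτ.toSubgraph) hτ (fun _ _ => Iff.rfl)]
  exact Nat.mul_le_mul_left 2 (hM.2 _ hτ.isMatching_toSubgraph)

theorem IsMaxInvMatching.mem_geD [Finite V] {σ : V → V} (hσ : IsMaxInvMatching G σ) {v : V}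
    (hv : σ v = v) : v ∈ geD G := by
  refine ⟨hσ.1.toSubgraph, ⟨hσ.1.isMatching_toSubgraph, fun N hN => ?_⟩, fun h => h hv⟩
  obtain ⟨τ, hτ, hNτ⟩ := exists_invMatching hN
  have := hσ.2 τ hτ
  rw [← two_mul_ncard_edgeSet hτ hNτ,
    ← two_mul_ncard_edgeSet (M := hσ.1.toSubgraph) hσ.1 (fun _ _ => Iff.rfl)] at this
  omega

theorem isInvMatching_id : IsInvMatching G id :=
  ⟨fun _ => rfl, fun _ h => absurd rfl h⟩

theorem exists_invMatching_pair {u v : V} (h : G.Adj u v) :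
    ∃ σ, IsInvMatching G σ ∧ movedSet σ = {u, v} := by
  classical
  refine ⟨Equiv.swap u v, ⟨fun w => Equiv.swap_apply_self u v w, fun w hw => ?_⟩, ?_⟩
  · rcases eq_or_ne w u with rfl | h1
    · simpa using h
    rcases eq_or_ne w v with rfl | h2
    · simpa using h.symm
    exact absurd (Equiv.swap_apply_of_ne_of_ne h1 h2) hw
  · ext w
    have := h.ne
    simp only [movedSet, Set.mem_ofPred_eq, Set.mem_insert_iff, Set.mem_singleton_iff,
      Equiv.swap_apply_ne_self_iff]
    tauto

/-- Matchings with disjoint vertex sets can be combined. -/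
theorem IsInvMatching.exists_union {σ τ : V → V} (hσ : IsInvMatching G σ)
    (hτ : IsInvMatching G τ) (hd : Disjoint (movedSet σ) (movedSet τ)) :
    ∃ ρ, IsInvMatching G ρ ∧ movedSet ρ = movedSet σ ∪ movedSet τ := by
  classical
  rw [Set.disjoint_left] at hd
  have h1 : ∀ v, σ v ≠ v → τ v = v := fun v hv => by_contra fun h => hd hv h
  have h2 : ∀ v, σ v ≠ v → σ (σ v) ≠ σ v := fun v hv => by rw [hσ.invol]; exact hv.symm
  have h3 : ∀ v, τ v ≠ v → τ (τ v) ≠ τ v := fun v hv => by rw [hτ.invol]; exact hv.symm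
  have h4 : ∀ v, τ v ≠ v → σ (τ v) = τ v := fun v hv => by_contra fun h => hd h (h3 v hv)
  have h5 : ∀ v, τ v ≠ v → σ v = v := fun v hv => by_contra fun h => hd h hv
  refine ⟨fun v => if σ v ≠ v then σ v else τ v, ⟨fun v => ?_, fun v => ?_⟩, ?_⟩
  · have := hσ.invol v
    have := hτ.invol v
    grind
  · have := hσ.adj v
    have := hτ.adj v
    grind
  · ext v
    simp only [movedSet, Set.mem_ofPred_eq, Set.mem_union]
    grind

/-- A path with an odd number of edges has a matching covering exactly its vertices. -/
theorem exists_invMatching_path : ∀ {u v : V} (p : G.Walk u v), p.IsPath → Odd p.length →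
    ∃ σ, IsInvMatching G σ ∧ movedSet σ = {w | w ∈ p.support}
  | _, _, .nil, _, ho => by simp at ho
  | _, _, .cons h .nil, _, _ => by
    obtain ⟨σ, h1, h2⟩ := exists_invMatching_pair h
    refine ⟨σ, h1, h2.trans ?_⟩
    ext; simp
  | _, _, .cons h (.cons h' q), hp, ho => by
    rw [Walk.cons_isPath_iff, Walk.cons_isPath_iff, Walk.support_cons, List.mem_cons, not_or] at hp
    obtain ⟨σ, h1, h2⟩ := exists_invMatching_pair h
    obtain ⟨τ, h3, h4⟩ := exists_invMatching_path q hp.1.1 (by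
      simp only [Walk.length_cons] at ho; grind)
    obtain ⟨ρ, h5, h6⟩ := h1.exists_union h3 (by
      rw [h2, h4, Set.disjoint_left]
      rintro w (rfl | rfl)
      · exact hp.2.2
      · exact hp.1.2)
    refine ⟨ρ, h5, ?_⟩
    rw [h6, h2, h4]
    ext; simp [or_assoc]

/-- An odd cycle minus a vertex has a perfect matching. -/
theorem exists_invMatching_cycle {b o : V} (c : G.Walk b b) (hc : c.IsCycle) (hl : Odd c.length)
    (ho : o ∈ c.support) :
    ∃ σ, IsInvMatching G σ ∧ movedSet σ = {v | v ∈ c.support} \ {o} := by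
  classical
  obtain ⟨d, hd, hdl, hds⟩ : ∃ d : G.Walk o o, d.IsCycle ∧ Odd d.length ∧
      ∀ v, v ∈ d.support ↔ v ∈ c.support :=
    ⟨c.rotate o ho, hc.rotate ho, by rwa [Walk.length_rotate], fun v => by
      rw [← Walk.mem_verts_toSubgraph, ← Walk.mem_verts_toSubgraph, Walk.toSubgraph_rotate]⟩
  cases d with
  | nil => simp at hdl
  | @cons _ y _ h q =>
    rw [Walk.cons_isCycle_iff] at hd
    have hq := hd.1.reverse
    have hev : Even q.reverse.length := by
      rw [Walk.length_cons] at hdl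
      rw [Walk.length_reverse]
      grind
    have hsupp : ∀ v, v ∈ q.reverse.support ↔ v ∈ c.support := by
      intro v
      rw [← hds, Walk.support_reverse, List.mem_reverse, Walk.support_cons, List.mem_cons]
      exact ⟨.inr, fun h => h.elim (fun h => h ▸ q.end_mem_support) id⟩
    generalize q.reverse = r at hq hev hsupp
    cases r with
    | nil => exact absurd rfl h.ne
    | cons h' r =>
      rw [Walk.cons_isPath_iff] at hq
      obtain ⟨σ, h1, h2⟩ := exists_invMatching_path r hq.1 (by
        rw [Walk.length_cons] at hev; grind)
      refine ⟨σ, h1, ?_⟩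
      rw [h2]
      ext v
      simp only [Set.mem_ofPred_eq, Set.mem_sdiff, Set.mem_singleton_iff, ← hsupp,
        Walk.support_cons, List.mem_cons]
      constructor
      · intro hv
        exact ⟨.inr hv, fun h => hq.2 (h ▸ hv)⟩
      · rintro ⟨h | h, hne⟩
        · exact absurd h hne
        · exact h

theorem ncard_support_of_isCycle {b : V} {c : G.Walk b b} (hc : c.IsCycle) :
    {v | v ∈ c.support}.ncard = c.length := by
  classical
  have : {v | v ∈ c.support} = (c.support.tail.toFinset : Set V) := by
    ext v
    rw [Set.mem_ofPred_eq, Finset.mem_coe, List.mem_toFinset]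
    cases c with
    | nil => exact absurd rfl hc.ne_nil
    | cons h q =>
      rw [Walk.support_cons, List.tail_cons, List.mem_cons]
      exact ⟨fun h => h.elim (fun h => h ▸ q.end_mem_support) id, .inr⟩
  rw [this, Set.ncard_coe_finset, List.toFinset_card_of_nodup hc.support_nodup]
  simp

/-- The maximum matching of a blossom covers the blossom, except for its base, by edges within
the blossom. -/
theorem IsBlossom.mem_support [Finite V] {M : G.Subgraph} {b : V} {c : G.Walk b b}
    (hc : IsBlossom M c) {σ : V → V} (hσ : IsInvMatching G σ)
    (hMσ : ∀ u v, M.Adj u v ↔ σ u = v ∧ u ≠ v) {v : V} (hv : v ∈ c.support) (hvb : v ≠ b) :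
    σ v ∈ c.support := by
  -- `T` consists of the ends of the `m` matching edges on the cycle. It misses `b` and has `2m`
  -- elements, so it is all of the cycle but `b`.
  set T : Set V := {v | σ v ≠ v ∧ s(v, σ v) ∈ c.edges} with hT
  have hTS : T ⊆ {v | v ∈ c.support} \ {b} := by
    rintro u ⟨hu, hue⟩
    refine ⟨c.fst_mem_support_of_mem_edges hue, ?_⟩
    rintro rfl
    exact hc.base _ hue (Sym2.mem_mk_left _ _) ((hMσ _ _).2 ⟨rfl, hu.symm⟩)
  have himg : (fun v => s(v, σ v)) '' T = {e | e ∈ c.edges ∧ e ∈ M.edgeSet} := by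
    ext e
    constructor
    · rintro ⟨u, hu, rfl⟩
      exact ⟨hu.2, (hMσ _ _).2 ⟨rfl, hu.1.symm⟩⟩
    · induction e with
      | h x y =>
        rintro ⟨h1, h2⟩
        obtain ⟨rfl, h3⟩ := (hMσ x y).1 h2
        exact ⟨x, ⟨h3.symm, h1⟩, rfl⟩
  have hcard : T.ncard = ({v | v ∈ c.support} \ {b}).ncard := by
    rw [← two_mul_ncard_image_edges hσ.invol T, himg, Set.ncard_sdiff_singleton_of_mem
      (show b ∈ {v | v ∈ c.support} from c.start_mem_support), ncard_support_of_isCycle hc.isCycle,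
      hc.length_eq]
    · rfl
    · rintro u ⟨h1, h2⟩
      refine ⟨⟨by rw [hσ.invol]; exact h1.symm, by rw [hσ.invol, Sym2.eq_swap]; exact h2⟩, h1⟩
  have heq := Set.eq_of_subset_of_ncard_le hTS hcard.ge (Set.toFinite _)
  have : v ∈ T := heq ▸ ⟨hv, hvb⟩
  exact c.snd_mem_support_of_mem_edges this.2

/-- Exchanging the matching edge `by` for `yx`, where `x` is exposed. -/
theorem IsMaxInvMatching.exists_shift [Finite V] {σ : V → V} (hσ : IsMaxInvMatching G σ)
    {b y x : V} (hby : σ b = y) (hne : b ≠ y) (hx : σ x = x) (hyx : G.Adj y x) :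
    ∃ τ, IsMaxInvMatching G τ ∧ τ b = b ∧ τ y = x ∧
      ∀ v, v ≠ b → v ≠ y → v ≠ x → τ v = σ v := by
  classical
  have hyb : σ y = b := by rw [← hby, hσ.1.invol]
  have hxb : x ≠ b := by rintro rfl; exact hne (hx.symm.trans hby)
  have hxy := hyx.ne
  have hinj := hσ.1.injective
  have hinv := hσ.1.invol
  refine ⟨fun v => if v = b then b else if v = y then x else if v = x then y else σ v,
    ⟨⟨fun v => ?_, fun v => ?_⟩, fun ρ hρ => (hσ.2 ρ hρ).trans ?_⟩, ?_, ?_, ?_⟩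
  · have h1 := hinv v
    have h2 : v ≠ y → σ v ≠ b := fun h h' => h (hinj (h'.trans hyb.symm))
    have h3 : v ≠ b → σ v ≠ y := fun h h' => h (hinj (h'.trans hby.symm))
    have h4 : v ≠ x → σ v ≠ x := fun h h' => h (hinj (h'.trans hx.symm))
    grind
  · have := hσ.1.adj v
    have := hyx.symm
    grind
  -- The exchange exposes `b` and covers `x`, so the number of covered vertices is unchanged and
  -- maximality persists.
  · have hb : b ∈ movedSet σ := by change σ b ≠ b; rw [hby]; exact hne.symm
    have hxm : x ∉ movedSet σ \ {b} := fun h => h.1 hx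
    have h1 := Set.ncard_sdiff_singleton_add_one hb
    have h2 := Set.ncard_insert_of_notMem hxm
    rw [← h1, ← h2]
    refine Set.ncard_le_ncard ?_ (Set.toFinite _)
    rintro v (rfl | ⟨h, h'⟩)
    · simp only [movedSet, Set.mem_ofPred_eq]; grind
    · have h' : v ≠ b := h'
      simp only [movedSet, Set.mem_ofPred_eq] at h ⊢
      grind
  · grind
  · grind
  · intros; grind

/-- Exchanging the matching along an even alternating path ending in an exposed vertex. -/
theorem IsMaxInvMatching.exists_shift_path [Finite V] {σ : V → V} (hσ : IsMaxInvMatching G σ) :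
    ∀ {b r : V} (p : G.Walk b r), p.IsPath → Even p.length → σ r = r →
    (∀ i, 2 * i < p.length → σ (p.getVert (2 * i)) = p.getVert (2 * i + 1)) →
    ∃ τ, IsMaxInvMatching G τ ∧ τ b = b ∧ (∀ v, v ∉ p.support → τ v = σ v) ∧
      ∀ i, 2 * i < p.length → τ (p.getVert (2 * i + 1)) = p.getVert (2 * i + 2)
  | _, _, .nil, _, _, hr, _ => ⟨σ, hσ, hr, fun _ _ => rfl, fun i hi => by simp at hi⟩
  | _, _, .cons h .nil, _, he, _, _ => by simp at he
  | b, r, .cons (v := y) h (.cons (v := x) h' q), hp, he, hr, halt => by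
    rw [Walk.cons_isPath_iff, Walk.cons_isPath_iff, Walk.support_cons, List.mem_cons, not_or] at hp
    -- Shifting the tail first exposes `x`, which is what the exchange on `b, y, x` requires.
    obtain ⟨τ, h1, h2, h3, h4⟩ := hσ.exists_shift_path q hp.1.1
      (by simp only [Walk.length_cons] at he; grind) hr (fun i hi => by
        have := halt (i + 1) (by simp only [Walk.length_cons]; omega)
        simpa [Nat.mul_add] using this)
    have hby : σ b = y := by simpa using halt 0 (by simp)
    obtain ⟨ρ, h5, h6, h7, h8⟩ := h1.exists_shift (b := b) (y := y) (x := x)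
      (by rw [h3 b hp.2.2, hby]) h.ne h2 h'
    refine ⟨ρ, h5, h6, fun v hv => ?_, fun i hi => ?_⟩
    · simp only [Walk.support_cons, List.mem_cons, not_or] at hv
      rw [h8 v hv.1 hv.2.1 (fun h => hv.2.2 (h ▸ q.start_mem_support)), h3 v hv.2.2]
    · rcases i with _ | i
      · simpa using h7
      · simp only [Walk.length_cons] at hi
        have h9 := h4 i (by omega)
        have hm := q.getVert_mem_support (2 * i + 1)
        have hm2 : ρ (q.getVert (2 * i + 1)) = q.getVert (2 * i + 2) := by
          rw [h8 _ (fun h => hp.2.2 (h ▸ hm)) (fun h => hp.1.2 (h ▸ hm)), h9]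
          intro hx
          have := (hp.1.1.getVert_eq_start_iff (i := 2 * i + 1) (by omega)).1 hx
          omega
        simpa [Nat.mul_add] using hm2

/-- The last edge is not in `M` because `r` is exposed; alternation carries this back to the start.
-/
theorem mem_edgeSet_of_alternating {M : G.Subgraph} {b r : V} (p : G.Walk b r)
    (hp : IsAlternatingWalk M p) (hr : r ∉ M.verts) :
    ∀ i < p.length, (M.Adj (p.getVert i) (p.getVert (i + 1)) ↔ Even (p.length - i)) := by
  induction p with
  | nil => simp
  | @cons u v r h q ih =>
    have hq : IsAlternatingWalk M q := by
      unfold IsAlternatingWalk at hp ⊢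
      rw [Walk.edges_cons] at hp
      exact hp.tail
    specialize ih hq hr
    intro i hi
    rcases i with _ | i
    · cases q with
      | nil =>
        simp only [Walk.getVert_cons_succ, Walk.getVert_zero, Walk.length_cons, Walk.length_nil]
        constructor
        · intro h
          exact absurd (M.edge_vert h.symm) hr
        · intro h; simp at h
      | cons h' q =>
        unfold IsAlternatingWalk at hp
        rw [Walk.edges_cons, Walk.edges_cons, List.isChain_cons_cons] at hp
        have h1 := hp.1
        have h2 := ih 0 (by simp)
        simp only [Walk.getVert_cons_succ, Walk.getVert_zero, Walk.length_cons, tsub_zero,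
          zero_add, Subgraph.mem_edgeSet] at h1 h2 ⊢
        rw [h1, h2]
        grind
    · have := ih i (by simpa using hi)
      simpa using this

end Involutions

/-! ### Hall's theorem with deficiency, and the tight set after contracting the odd cycle. -/

section Deficiency

/-- Hall's theorem with deficiency `d`. -/
theorem exists_injOn_of_deficiency {α : Type*} [DecidableEq α] (Y : Finset α)
    (N : α → Finset α) (d : ℕ) (h : ∀ s ⊆ Y, s.card ≤ (s.biUnion N).card + d) :
    ∃ Z ⊆ Y, ∃ g : α → α, Set.InjOn g Z ∧ (∀ y ∈ Z, g y ∈ N y) ∧ Y.card ≤ Z.card + d := by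
  classical
  -- Adding `d` dummy vertices adjacent to everything in `Y` restores Hall's condition; at most `d`
  -- elements are then matched to dummies.
  let t : Y → Finset (α ⊕ Fin d) := fun y => (N y).disjSum Finset.univ
  have hall : ∀ s : Finset Y, s.card ≤ (s.biUnion t).card := by
    intro s
    rcases s.eq_empty_or_nonempty with rfl | ⟨y₀, hy₀⟩
    · simp
    have hsub : ((s.map (Function.Embedding.subtype _)).biUnion N).disjSum
        (Finset.univ : Finset (Fin d)) ⊆ s.biUnion t := by
      rintro (x | i) hx
      · rw [Finset.inl_mem_disjSum, Finset.mem_biUnion] at hx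
        obtain ⟨y, hy, hxy⟩ := hx
        obtain ⟨y', hy', rfl⟩ := Finset.mem_map.1 hy
        exact Finset.mem_biUnion.2 ⟨y', hy', Finset.inl_mem_disjSum.2 hxy⟩
      · exact Finset.mem_biUnion.2 ⟨y₀, hy₀, Finset.inr_mem_disjSum.2 (Finset.mem_univ _)⟩
    have h1 := Finset.card_le_card hsub
    rw [Finset.card_disjSum, Finset.card_univ, Fintype.card_fin] at h1
    have h2 := h (s.map (Function.Embedding.subtype _)) (by
      intro y hy
      obtain ⟨y', -, rfl⟩ := Finset.mem_map.1 hy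
      exact y'.2)
    rw [Finset.card_map] at h2
    exact h2.trans h1
  obtain ⟨f, hf, hft⟩ := (Finset.all_card_le_biUnion_card_iff_exists_injective t).1 hall
  let F : α → α ⊕ Fin d := fun y => if hy : y ∈ Y then f ⟨y, hy⟩ else .inl y
  have hF : Set.InjOn F Y := by
    intro y hy z hz hyz
    simp only [F, dif_pos (Finset.mem_coe.1 hy), dif_pos (Finset.mem_coe.1 hz)] at hyz
    exact congrArg Subtype.val (hf hyz)
  have hFt : ∀ y ∈ Y, ∀ x, F y = .inl x → x ∈ N y := by
    intro y hy x hx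
    simp only [F, dif_pos hy] at hx
    have := hft ⟨y, hy⟩
    rw [hx] at this
    exact Finset.inl_mem_disjSum.1 this
  refine ⟨Y.filter fun y => (F y).isLeft, Finset.filter_subset _ _,
    fun y => Sum.elim id (fun _ => y) (F y), ?_, ?_, ?_⟩
  · intro y hy z hz hyz
    rw [Finset.mem_coe, Finset.mem_filter] at hy hz
    obtain ⟨x, hx⟩ := Sum.isLeft_iff.1 hy.2
    obtain ⟨w, hw⟩ := Sum.isLeft_iff.1 hz.2
    simp only [hx, hw, Sum.elim_inl, id] at hyz
    exact hF hy.1 hz.1 (by rw [hx, hw, hyz])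
  · intro y hy
    rw [Finset.mem_filter] at hy
    obtain ⟨x, hx⟩ := Sum.isLeft_iff.1 hy.2
    simp only [hx, Sum.elim_inl, id]
    exact hFt y hy.1 x hx
  · rw [← Finset.card_filter_add_card_filter_not (s := Y) (fun y => (F y).isLeft = true)]
    refine Nat.add_le_add_left ?_ _
    have : ((Y.filter fun y => ¬ (F y).isLeft).image F) ⊆
        (∅ : Finset α).disjSum (Finset.univ : Finset (Fin d)) := by
      intro z hz
      obtain ⟨y, hy, rfl⟩ := Finset.mem_image.1 hz
      have := (Finset.mem_filter.1 hy).2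
      cases hFy : F y with
      | inl x => simp [hFy] at this
      | inr i => simp
    have h1 := Finset.card_le_card this
    rw [Finset.card_image_of_injOn (hF.mono fun y hy => (Finset.mem_filter.1 hy).1)] at h1
    simpa using h1

variable {V : Type*} {G : SimpleGraph V}

theorem exists_invMatching_of_injOn [DecidableEq V] (g : V → V) (Z : Finset V)
    (hg : Set.InjOn g Z) (hadj : ∀ y ∈ Z, G.Adj y (g y)) (hd : ∀ y ∈ Z, g y ∉ Z) :
    ∃ σ, IsInvMatching G σ ∧ movedSet σ = (Z ∪ Z.image g : Finset V) := by
  suffices h : ∀ W ⊆ Z, ∃ σ, IsInvMatching G σ ∧ movedSet σ = (W ∪ W.image g : Finset V) from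
    h Z subset_rfl
  intro W
  induction W using Finset.induction_on with
  | empty =>
    intro _
    refine ⟨id, isInvMatching_id, ?_⟩
    ext v; simp [movedSet]
  | insert y W hy ih =>
    intro hW
    have hyZ := hW (Finset.mem_insert_self y W)
    have hWZ : W ⊆ Z := fun w hw => hW (Finset.mem_insert_of_mem hw)
    obtain ⟨σ, h1, h2⟩ := ih hWZ
    obtain ⟨τ, h3, h4⟩ := exists_invMatching_pair (hadj y hyZ)
    obtain ⟨ρ, h5, h6⟩ := h3.exists_union h1 (by
      rw [h2, h4, Set.disjoint_left]
      rintro w (rfl | rfl) hw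
      · rcases Finset.mem_union.1 (Finset.mem_coe.1 hw) with hw | hw
        · exact hy hw
        · obtain ⟨z, hz, hzw⟩ := Finset.mem_image.1 hw
          exact hd z (hWZ hz) (hzw ▸ hyZ)
      · rcases Finset.mem_union.1 (Finset.mem_coe.1 hw) with hw | hw
        · exact hd y hyZ (hWZ hw)
        · obtain ⟨z, hz, hzw⟩ := Finset.mem_image.1 hw
          exact hy (hg (hWZ hz) hyZ hzw ▸ hz))
    refine ⟨ρ, h5, ?_⟩
    rw [h6, h4, h2]
    ext v
    simp only [Set.mem_union, Set.mem_insert_iff, Set.mem_singleton_iff, Finset.mem_coe,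
      Finset.mem_union, Finset.mem_insert, Finset.image_insert]
    tauto

/-- Duality for the bipartite graph obtained by contracting `S`: there is `T ⊆ Y` such that every
maximum matching that is near-perfect on `S` saturates `Y \ T` and all neighbours of `T`, the
latter into `T`; moreover no vertex of `T` is adjacent to `S`. -/
theorem exists_tight_set [Finite V] {S Y : Set V} (hSY : Disjoint S Y) (hSn : S.Nonempty)
    (hS : ∀ o ∈ S, ∃ ρ, IsInvMatching G ρ ∧ movedSet ρ = S \ {o})
    (hX : ∀ u ∉ Y, u ∉ S → ∀ v, G.Adj u v → v ∈ Y)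
    (hY : ∀ u ∈ Y, ∀ v, G.Adj u v → v ∉ Y) :
    ∃ T ⊆ Y, ∀ b ∈ S, ∀ τ, IsMaxInvMatching G τ → τ b = b → (∀ v ∈ S, τ v ∈ S) →
      (∀ y ∈ T, ∀ o ∈ S, ¬ G.Adj y o) ∧ (∀ y ∈ Y, y ∉ T → τ y ≠ y) ∧
      (∀ y ∈ T, ∀ x, x ∉ S → G.Adj y x → τ x ∈ T) := by
  classical
  have := Fintype.ofFinite V
  obtain ⟨b₀, hb₀⟩ := hSn
  rw [Set.disjoint_left] at hSY
  -- Neighbourhoods after contracting `S` to a single point, represented by `b₀`.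
  let N : V → Finset V := fun y => Finset.univ.filter fun x =>
    (x ∉ S ∧ x ∉ Y ∧ G.Adj y x) ∨ (x = b₀ ∧ ∃ o ∈ S, G.Adj y o)
  have hN : ∀ x y, x ∈ N y ↔ (x ∉ S ∧ x ∉ Y ∧ G.Adj y x) ∨ (x = b₀ ∧ ∃ o ∈ S, G.Adj y o) := by
    intro x y; simp [N]
  let Yf : Finset V := Y.toFinset
  have hYf : ∀ v, v ∈ Yf ↔ v ∈ Y := fun v => Set.mem_toFinset
  -- `T` attains the maximum deficiency `d`, so all but at most `d` elements of `Y` can be matched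
  -- in the contracted graph.
  obtain ⟨T, hT, hmax⟩ := Finset.exists_max_image Yf.powerset
    (fun T => (T.card : ℤ) - ((T.biUnion N).card : ℤ)) ⟨∅, Finset.empty_mem_powerset _⟩
  rw [Finset.mem_powerset] at hT
  have h0 : (T.biUnion N).card ≤ T.card := by
    have := hmax ∅ (Finset.empty_mem_powerset _)
    simp at this
    exact this
  obtain ⟨d, hd⟩ := Nat.exists_eq_add_of_le h0
  obtain ⟨Z, hZY, g, hg, hgN, hZcard⟩ := exists_injOn_of_deficiency Yf N d (by
    intro s hs
    have := hmax s (Finset.mem_powerset.2 hs)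
    omega)
  refine ⟨T, fun y hy => (hYf y).1 (hT hy), ?_⟩
  intro b hb τ hτ hτb hτS
  -- lift the contracted matching to `G`
  obtain ⟨o, hoS, ho⟩ : ∃ o ∈ S, ∀ y ∈ Z, g y = b₀ → G.Adj y o := by
    by_cases h : ∃ y ∈ Z, g y = b₀
    · obtain ⟨y, hy, hyb⟩ := h
      rcases (hN _ _).1 (hgN y hy) with h | ⟨-, o, ho, hyo⟩
      · exact absurd (hyb ▸ hb₀) h.1
      · refine ⟨o, ho, fun z hz hzb => ?_⟩
        rwa [hg hz hy (hzb.trans hyb.symm)]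
    · exact ⟨b₀, hb₀, fun y hy hyb => absurd ⟨y, hy, hyb⟩ h⟩
  -- By injectivity at most one element of `Z` uses the contracted point; it is matched to `o`
  -- instead, and the rest of `S` gets the perfect matching of `S \ {o}`.
  let g' : V → V := fun y => if g y = b₀ then o else g y
  have hg'1 : ∀ y ∈ Z, G.Adj y (g' y) ∧ g' y ∉ Y ∧ (g' y ∈ S → g' y = o) := by
    intro y hy
    by_cases h : g y = b₀
    · simp only [g', if_pos h]
      exact ⟨ho y hy h, hSY hoS, fun _ => trivial⟩
    · simp only [g', if_neg h]
      rcases (hN _ _).1 (hgN y hy) with h' | h'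
      · exact ⟨h'.2.2, h'.2.1, fun h'' => absurd h'' h'.1⟩
      · exact absurd h'.1 h
  have hg'S : ∀ y ∈ Z, g y ≠ b₀ → g y ∉ S := by
    intro y hy h
    rcases (hN _ _).1 (hgN y hy) with h' | h'
    · exact h'.1
    · exact absurd h'.1 h
  have hg'inj : Set.InjOn g' Z := by
    intro y hy z hz hyz
    have h1 := hg'S y hy
    have h2 := hg'S z hz
    apply hg hy hz
    simp only [g'] at hyz
    split_ifs at hyz with h3 h4 h4
    · rw [h3, h4]
    · exact absurd (hyz ▸ hoS) (h2 h4)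
    · exact absurd (hyz ▸ hoS) (h1 h3)
    · exact hyz
  have hZd : ∀ y ∈ Z, g' y ∉ Z := fun y hy h => (hg'1 y hy).2.1 ((hYf _).1 (hZY h))
  obtain ⟨σ, hσ, hσm⟩ := exists_invMatching_of_injOn g' Z hg'inj (fun y hy => (hg'1 y hy).1) hZd
  obtain ⟨ρ, hρ, hρm⟩ := hS o hoS
  have hdisj : Disjoint (movedSet σ) (movedSet ρ) := by
    rw [hσm, hρm, Set.disjoint_left]
    rintro v hv ⟨hvS, hvo⟩
    rcases Finset.mem_union.1 (Finset.mem_coe.1 hv) with hv | hv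
    · exact hSY hvS ((hYf _).1 (hZY hv))
    · obtain ⟨y, hy, rfl⟩ := Finset.mem_image.1 hv
      exact hvo ((hg'1 y hy).2.2 hvS)
  obtain ⟨π, hπ, hπm⟩ := hσ.exists_union hρ hdisj
  have hlow : 2 * Z.card + (S.ncard - 1) ≤ (movedSet τ).ncard := by
    refine le_trans (le_of_eq ?_) (hτ.2 π hπ)
    rw [hπm, Set.ncard_union_eq hdisj (Set.toFinite _) (Set.toFinite _), hσm, hρm,
      Set.ncard_coe_finset, Set.ncard_sdiff_singleton_of_mem hoS, Finset.card_union_of_disjoint,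
      Finset.card_image_of_injOn hg'inj, two_mul]
    rw [Finset.disjoint_right]
    intro v hv
    obtain ⟨y, hy, rfl⟩ := Finset.mem_image.1 hv
    exact hZd y hy
  -- bound the given matching from above
  let A : Finset V := Yf.filter fun y => τ y ≠ y
  have hA : ∀ v, v ∈ A ↔ v ∈ Y ∧ τ v ≠ v := fun v => by simp [A, hYf]
  have hupp : (movedSet τ).ncard ≤ (S.ncard - 1) + 2 * A.card := by
    have hsub : movedSet τ ⊆ (S \ {b}) ∪ ((A ∪ A.image τ : Finset V) : Set V) := by
      intro v hv
      by_cases hvS : v ∈ S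
      · exact .inl ⟨hvS, fun h => hv (by rw [Set.mem_singleton_iff.1 h]; exact hτb)⟩
      · refine .inr (Finset.mem_coe.2 (Finset.mem_union.2 ?_))
        by_cases hvY : v ∈ Y
        · exact .inl ((hA v).2 ⟨hvY, hv⟩)
        · refine .inr (Finset.mem_image.2 ⟨τ v, (hA _).2 ⟨?_, ?_⟩, hτ.1.invol v⟩)
          · exact hX v hvY hvS _ (hτ.1.adj v hv)
          · rw [hτ.1.invol]; exact Ne.symm hv
    refine (Set.ncard_le_ncard hsub (Set.toFinite _)).trans
      ((Set.ncard_union_le _ _).trans ?_)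
    rw [Set.ncard_sdiff_singleton_of_mem hb, Set.ncard_coe_finset]
    have h1 := Finset.card_union_le A (A.image τ)
    have h2 : (A.image τ).card ≤ A.card := Finset.card_image_le
    omega
  have hZA : Z.card ≤ A.card := by omega
  have hsplit := Finset.card_filter_add_card_filter_not (s := A) (fun y => y ∈ T)
  have hB1 : A.filter (fun y => y ∉ T) ⊆ Yf \ T := by
    intro y hy
    rw [Finset.mem_filter, hA] at hy
    exact Finset.mem_sdiff.2 ⟨(hYf y).2 hy.1.1, hy.2⟩
  have hSτ : ∀ v, τ v ∈ S → v ∈ S := fun v hv => hτ.1.invol v ▸ hτS _ hv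
  have hB2 : (A.filter (fun y => y ∈ T)).image τ ⊆ (T.biUnion N).erase b₀ := by
    intro x hx
    obtain ⟨y, hy, rfl⟩ := Finset.mem_image.1 hx
    rw [Finset.mem_filter, hA] at hy
    have hyS : τ y ∉ S := fun h => hSY (hSτ y h) hy.1.1
    have hadj := hτ.1.adj y hy.1.2
    refine Finset.mem_erase.2 ⟨fun h => hyS (h ▸ hb₀), Finset.mem_biUnion.2 ⟨y, hy.2, ?_⟩⟩
    exact (hN _ _).2 (.inl ⟨hyS, hY y hy.1.1 _ hadj, hadj⟩)
  have hc1 := Finset.card_le_card hB1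
  have hc2 := Finset.card_le_card (hB2.trans (Finset.erase_subset _ _))
  rw [Finset.card_image_of_injective _ hτ.1.injective] at hc2
  have hc3 := Finset.card_sdiff_add_card_eq_card hT
  -- `|Y| - d ≤ |Z| ≤ |A| ≤ |Y \ T| + |N(T)| = |Y| - d`, so equality holds throughout. Since the
  -- partners of `T` avoid `b₀` yet exhaust `N(T)`, also `b₀ ∉ N(T)`.
  have heq1 := Finset.eq_of_subset_of_card_le hB1 (by omega)
  have heq2 := Finset.eq_of_subset_of_card_le (hB2.trans (Finset.erase_subset _ _))
    (by rw [Finset.card_image_of_injective _ hτ.1.injective]; omega)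
  refine ⟨fun y hy o' ho' hadj => ?_, fun y hy hyT => ?_, fun y hy x hxS hadj => ?_⟩
  · have : b₀ ∈ T.biUnion N := Finset.mem_biUnion.2 ⟨y, hy, (hN _ _).2 (.inr ⟨rfl, o', ho', hadj⟩)⟩
    rw [← heq2] at this
    exact (Finset.mem_erase.1 (hB2 this)).1 rfl
  · have : y ∈ Yf \ T := Finset.mem_sdiff.2 ⟨(hYf y).2 hy, hyT⟩
    rw [← heq1, Finset.mem_filter, hA] at this
    exact this.1.2
  · have : x ∈ T.biUnion N := Finset.mem_biUnion.2
      ⟨y, hy, (hN _ _).2 (.inl ⟨hxS, hY y ((hYf y).1 (hT hy)) x hadj, hadj⟩)⟩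
    rw [← heq2] at this
    obtain ⟨z, hz, rfl⟩ := Finset.mem_image.1 this
    rw [hτ.1.invol]
    exact (Finset.mem_filter.1 hz).2

end Deficiency

/-! ### From flowers to the sets `I` and `Y` in an almost bipartite part. -/

section Flowers

variable {V : Type*} {G : SimpleGraph V}

/-- Moving the exposed vertex of a flower along the stem. -/
theorem IsFlower.exists_shift [Finite V] {M : G.Subgraph} (hM : IsMaximumMatching M) {b r : V}
    {c : G.Walk b b} {p : G.Walk b r} (hf : IsFlower M c p) :
    (∀ j ≤ p.length, Even j → p.getVert j ∈ geD G) ∧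
    ∃ τ, IsMaxInvMatching G τ ∧ τ b = b ∧ (∀ v ∈ c.support, τ v ∈ c.support) ∧
      ∀ i, 2 * i < p.length → τ (p.getVert (2 * i + 1)) = p.getVert (2 * i + 2) := by
  obtain ⟨σ, hσ, hMσ⟩ := hM.exists_isMaxInvMatching
  have hr : σ r = r := by
    by_contra h
    exact hf.root (M.edge_vert ((hMσ r (σ r)).2 ⟨rfl, Ne.symm h⟩))
  have halt : ∀ i < p.length, Even i → σ (p.getVert i) = p.getVert (i + 1) := by
    intro i hi he
    have := (mem_edgeSet_of_alternating p hf.alternating hf.root i hi).2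
      (by have := hf.even_length; grind)
    exact ((hMσ _ _).1 this).1
  constructor
  · intro j hj he
    -- Shifting only the part of the stem beyond an even index `j` exposes its `j`-th vertex.
    obtain ⟨τ, h1, h2, -⟩ := hσ.exists_shift_path (p.drop j) (hf.isPath.drop j)
      (by have := hf.even_length; rw [Walk.drop_length]; grind) hr (fun i hi => by
        rw [Walk.drop_length] at hi
        rw [Walk.drop_getVert, Walk.drop_getVert]
        exact halt (j + 2 * i) (by omega) (by grind))
    exact h1.mem_geD h2
  · obtain ⟨τ, h1, h2, h3, h4⟩ := hσ.exists_shift_path p hf.isPath hf.even_length hr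
      (fun i hi => halt _ hi (by simp))
    refine ⟨τ, h1, h2, fun v hv => ?_, h4⟩
    by_cases hvb : v = b
    · rw [hvb, h2]; exact c.start_mem_support
    · rw [h3 v fun hvp => hvb (hf.inter v hv hvp)]
      exact hf.blossom.mem_support hσ.1 hMσ hv hvb

theorem IsFlower.notMem_edges {M : G.Subgraph} {b r : V} {c : G.Walk b b} {p : G.Walk b r}
    (hf : IsFlower M c p) : ∀ e ∈ p.edges, e ∉ c.edges := by
  intro e
  induction e with
  | h x y =>
    intro h1 h2
    have hx := hf.inter x (c.fst_mem_support_of_mem_edges h2) (p.fst_mem_support_of_mem_edges h1)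
    have hy := hf.inter y (c.snd_mem_support_of_mem_edges h2) (p.snd_mem_support_of_mem_edges h1)
    exact (p.adj_of_mem_edges h1).ne (hx.trans hy.symm)

/-- A maximum matching that is near-perfect on `S` can be made to miss any vertex of `S`. -/
theorem IsMaxInvMatching.mem_geD_of_mem [Finite V] {S : Set V} {τ : V → V}
    (hτ : IsMaxInvMatching G τ) {b : V} (hb : b ∈ S) (hτb : τ b = b) (hτS : ∀ v ∈ S, τ v ∈ S)
    {o : V} (ho : o ∈ S) {ρ : V → V} (hρ : IsInvMatching G ρ) (hρm : movedSet ρ = S \ {o}) :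
    o ∈ geD G := by
  classical
  have hSτ : ∀ v, τ v ∈ S → v ∈ S := fun v hv => hτ.1.invol v ▸ hτS _ hv
  -- Erase `τ` on `S` and use `ρ` there instead: both cover all of `S` except one vertex.
  have hσ : IsInvMatching G (fun v => if v ∈ S then v else τ v) := by
    refine ⟨fun v => ?_, fun v => ?_⟩
    · have := hτ.1.invol v
      have := hSτ v
      grind
    · have := hτ.1.adj v
      grind
  have hσm : movedSet (fun v => if v ∈ S then v else τ v) = movedSet τ \ S := by
    ext v
    simp only [movedSet, Set.mem_ofPred_eq, Set.mem_sdiff]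
    grind
  have hdisj : Disjoint (movedSet τ \ S) (S \ {o}) :=
    Set.disjoint_left.2 fun v h1 h2 => h1.2 h2.1
  obtain ⟨π, hπ, hπm⟩ := hσ.exists_union hρ (by rw [hσm, hρm]; exact hdisj)
  rw [hσm, hρm] at hπm
  have hmax : IsMaxInvMatching G π := by
    refine ⟨hπ, fun κ hκ => (hτ.2 κ hκ).trans ?_⟩
    rw [hπm, Set.ncard_union_eq hdisj (Set.toFinite _) (Set.toFinite _),
      Set.ncard_sdiff_singleton_of_mem ho, ← Set.ncard_sdiff_singleton_of_mem hb]
    refine (Set.ncard_le_ncard ?_ (Set.toFinite _)).trans (Set.ncard_union_le _ _)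
    intro v hv
    by_cases hvS : v ∈ S
    · exact .inr ⟨hvS, fun h => hv (by rw [Set.mem_singleton_iff.1 h]; exact hτb)⟩
    · exact .inl ⟨hv, hvS⟩
  refine hmax.mem_geD (by_contra fun h => ?_)
  have : o ∈ movedSet π := h
  rw [hπm] at this
  rcases this with h | h
  · exact h.2 ho
  · exact h.2 rfl

/-- An almost bipartite graph whose odd cycle reaches every vertex contains a set `I` with at
least as many vertices as a set `Y` containing all neighbours of `I` and all of `A(G)`. -/
theorem exists_independent_set [Finite V] (hab : IsAlmostBipartite G)
    (hreach : ∀ C : G.Subgraph, IsOddCycle C → reachSet C = Set.univ) :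
    ∃ I Y : Set V, geA G ⊆ Y ∧ Disjoint I Y ∧ (∀ u ∈ I, ∀ v, G.Adj u v → v ∈ Y) ∧
      Y.ncard ≤ I.ncard := by
  obtain ⟨O, hO, huniq⟩ := hab
  replace hreach := hreach O hO
  have hpar := fun s t hs ht w hw => even_of_avoids hO huniq (s := s) (t := t) hs ht w hw
  -- `e = true` records even length.
  let R : V → V → Bool → Prop := fun s v e =>
    ∃ w : G.Walk s v, (∀ e ∈ w.edges, e ∉ O.edgeSet) ∧ (Even w.length ↔ e = true)
  let Y : Set V := {v | ¬ ∃ s ∈ O.verts, R s v true}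
  have hflower : ∀ v, ∃ M : G.Subgraph, IsMaximumMatching M ∧
      ∃ (b r : V) (c : G.Walk b b) (p : G.Walk b r),
        IsFlower M c p ∧ c.toSubgraph = O ∧ (v ∈ c.support ∨ v ∈ p.support) := by
    intro v
    have : v ∈ reachSet O := hreach ▸ Set.mem_univ v
    exact this
  have hstem : ∀ {M : G.Subgraph} {b r : V} {c : G.Walk b b} {p : G.Walk b r},
      IsFlower M c p → c.toSubgraph = O → ∀ j ≤ p.length,
      R b (p.getVert j) (decide (Even j)) := by
    intro M b r c p hf hc j hj
    refine ⟨p.take j, fun e he => ?_, ?_⟩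
    · rw [← hc, Walk.mem_edges_toSubgraph]
      refine hf.notMem_edges e ?_
      exact (p.isSubwalk_take j).edges_subset he
    · rw [Walk.take_length, min_eq_left hj]; simp
  have hSY : ∀ s ∈ O.verts, s ∉ Y := fun s hs h => h ⟨s, hs, .nil, by simp, by simp⟩
  have hsupp : ∀ {b : V} {c : G.Walk b b}, c.toSubgraph = O → ∀ v, v ∈ c.support ↔ v ∈ O.verts := by
    rintro b c rfl v; rw [Walk.mem_verts_toSubgraph]
  -- every vertex of `Y` is at odd distance from `O`
  have hYodd : ∀ v ∈ Y, ∃ s ∈ O.verts, R s v false := by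
    intro v hv
    obtain ⟨M, hM, b, r, c, p, hf, hc, h⟩ := hflower v
    have hb : b ∈ O.verts := (hsupp hc b).1 c.start_mem_support
    rcases h with h | h
    · exact absurd hv (hSY v ((hsupp hc v).1 h))
    · obtain ⟨j, rfl, hj⟩ := Walk.mem_support_iff_exists_getVert.1 h
      have := hstem hf hc j hj
      by_cases he : Even j
      · rw [decide_eq_true he] at this
        exact absurd ⟨b, hb, this⟩ hv
      · rw [decide_eq_false he] at this
        exact ⟨b, hb, this⟩
  have hparity : ∀ s ∈ O.verts, ∀ t ∈ O.verts, ∀ v e f, R s v e → R t v f → e = f := by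
    rintro s hs t ht v e f ⟨w, hw, hwe⟩ ⟨w', hw', hwf⟩
    have := hpar s t hs ht (w.append w'.reverse) (by
      intro x hx
      rw [Walk.edges_append, List.mem_append, Walk.edges_reverse, List.mem_reverse] at hx
      exact hx.elim (hw x) (hw' x))
    rw [Walk.length_append, Walk.length_reverse, Nat.even_add, hwe, hwf] at this
    exact Bool.eq_iff_iff.2 this
  have hstep : ∀ s u v e, R s u e → G.Adj u v → s(u, v) ∉ O.edgeSet → R s v (!e) := by
    rintro s u v e ⟨w, hw, hwe⟩ hadj huv
    refine ⟨w.concat hadj, fun x hx => ?_, ?_⟩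
    · rw [Walk.edges_concat, List.concat_eq_append, List.mem_append, List.mem_singleton] at hx
      rcases hx with hx | rfl
      · exact hw x hx
      · exact huv
    · rw [Walk.length_concat, Nat.even_add_one, hwe]; simp
  have hOedge : ∀ u v, s(u, v) ∈ O.edgeSet → u ∈ O.verts ∧ v ∈ O.verts := fun u v h =>
    ⟨O.edge_vert h, O.edge_vert (O.symm.symm _ _ h)⟩
  have hX : ∀ u ∉ Y, u ∉ O.verts → ∀ v, G.Adj u v → v ∈ Y := by
    rintro u hu huO v hadj ⟨t, ht, h⟩
    obtain ⟨s, hs, h'⟩ := not_not.1 hu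
    have := hparity t ht s hs v _ _ h
      (hstep s u v _ h' hadj fun h => huO (hOedge _ _ h).1)
    simp at this
  have hY : ∀ u ∈ Y, ∀ v, G.Adj u v → v ∉ Y := by
    intro u hu v hadj hv
    obtain ⟨s, hs, h⟩ := hYodd u hu
    exact hv ⟨s, hs, hstep s u v _ h hadj fun h => hSY u (hOedge _ _ h).1 hu⟩
  have hnear : ∀ o ∈ O.verts, ∃ ρ, IsInvMatching G ρ ∧ movedSet ρ = O.verts \ {o} := by
    intro o ho
    obtain ⟨v, c, hc, hcl, hcO⟩ := hO
    obtain ⟨ρ, h1, h2⟩ := exists_invMatching_cycle c hc hcl ((hsupp hcO o).2 ho)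
    refine ⟨ρ, h1, h2.trans ?_⟩
    congr 1
    ext w; exact hsupp hcO w
  have hOn : O.verts.Nonempty := by
    obtain ⟨v, c, -, -, hcO⟩ := hO
    exact ⟨v, (hsupp hcO v).1 c.start_mem_support⟩
  -- A vertex of `O` is exposed by rematching the cycle; any other vertex outside `Y` sits, by
  -- parity, at an even position of its stem.
  have hD : ∀ v ∉ Y, v ∈ geD G := by
    intro v hv
    obtain ⟨M, hM, b, r, c, p, hf, hc, h⟩ := hflower v
    have hb : b ∈ O.verts := (hsupp hc b).1 c.start_mem_support
    obtain ⟨hDp, τ, h1, h2, h3, -⟩ := hf.exists_shift hM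
    by_cases hvO : v ∈ O.verts
    · obtain ⟨ρ, h4, h5⟩ := hnear v hvO
      exact h1.mem_geD_of_mem hb h2 (fun w hw => (hsupp hc _).1 (h3 w ((hsupp hc w).2 hw))) hvO h4 h5
    · rcases h with h | h
      · exact absurd ((hsupp hc v).1 h) hvO
      · obtain ⟨j, rfl, hj⟩ := Walk.mem_support_iff_exists_getVert.1 h
        obtain ⟨s, hs, h'⟩ := not_not.1 hv
        have := hparity b hb s hs _ _ _ (hstem hf hc j hj) h'
        exact hDp j hj (of_decide_eq_true this)
  obtain ⟨T, hTY, hT⟩ := exists_tight_set (Set.disjoint_left.2 hSY) hOn hnear hX hY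
  have hTempty : ∀ y ∈ Y, y ∉ T := by
    intro y hy
    obtain ⟨M, hM, b, r, c, p, hf, hc, h⟩ := hflower y
    have hb : b ∈ O.verts := (hsupp hc b).1 c.start_mem_support
    obtain ⟨-, τ, h1, h2, h3, h4⟩ := hf.exists_shift hM
    obtain ⟨hT1, -, hT3⟩ := hT b hb τ h1 h2
      (fun w hw => (hsupp hc _).1 (h3 w ((hsupp hc w).2 hw)))
    -- The first stem vertex after `b` is adjacent to `O`, so it is not in `T`. If a later odd
    -- vertex were in `T`, the even vertex before it would have its `τ`-partner in `T`, and that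
    -- partner is the previous odd vertex.
    have key : ∀ i, 2 * i < p.length → p.getVert (2 * i + 1) ∉ T := by
      intro i
      induction i with
      | zero =>
        intro hi hmem
        have := p.adj_getVert_succ hi
        simp only [mul_zero, Walk.getVert_zero] at this
        exact hT1 _ hmem b hb this.symm
      | succ i ih =>
        intro hi hmem
        have hlt : 2 * i < p.length := by omega
        have hx : p.getVert (2 * i + 2) ∉ O.verts := by
          intro hxO
          have := hf.inter _ ((hsupp hc _).2 hxO) (p.getVert_mem_support _)
          have := (hf.isPath.getVert_eq_start_iff (i := 2 * i + 2) (by omega)).1 this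
          omega
        have := hT3 _ hmem _ hx (p.adj_getVert_succ (i := 2 * i + 2) (by omega)).symm
        rw [← h4 i hlt, h1.1.invol] at this
        exact ih hlt this
    rcases h with h | h
    · exact absurd hy (hSY y ((hsupp hc y).1 h))
    · obtain ⟨j, rfl, hj⟩ := Walk.mem_support_iff_exists_getVert.1 h
      obtain ⟨s, hs, h'⟩ := hYodd _ hy
      have := hparity b hb s hs _ _ _ (hstem hf hc j hj) h'
      have hodd : Odd j := Nat.not_even_iff_odd.1 (of_decide_eq_false this)
      obtain ⟨i, rfl⟩ := hodd
      exact key i (by omega)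
  refine ⟨{v | v ∉ Y ∧ v ∉ O.verts}, Y, ?_, ?_, fun u hu => hX u hu.1 hu.2, ?_⟩
  · rintro v ⟨hv, -⟩
    by_contra h
    exact hv (hD v h)
  · exact Set.disjoint_left.2 fun v hv => hv.1
  · obtain ⟨s, hs⟩ := hOn
    obtain ⟨M, hM, b, r, c, p, hf, hc, -⟩ := hflower s
    have hb : b ∈ O.verts := (hsupp hc b).1 c.start_mem_support
    obtain ⟨-, τ, h1, h2, h3, -⟩ := hf.exists_shift hM
    have hτO := fun w hw => (hsupp hc _).1 (h3 w ((hsupp hc w).2 hw))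
    obtain ⟨-, hT2, -⟩ := hT b hb τ h1 h2 hτO
    -- As `T` is empty, `τ` saturates `Y`; partners lie outside `Y`, and outside `O` because `τ`
    -- preserves `O`.
    refine Set.ncard_le_ncard_of_injOn τ (fun y hy => ⟨?_, fun h => ?_⟩)
      h1.1.injective.injOn (Set.toFinite _)
    · exact hY y hy _ (h1.1.adj y (hT2 y hy (hTempty y hy)))
    · have := hτO _ h
      rw [h1.1.invol] at this
      exact hSY y this hy

end Flowers

/-! ### Sachs subgraphs as fractional perfect matchings. -/

section Sachs

variable {V : Type*} {G : SimpleGraph V}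

theorem card_neighborSet_completeGraph_two (v : Fin 2) :
    Nat.card ((completeGraph (Fin 2)).neighborSet v) = 1 := by
  rw [Nat.card_eq_fintype_card, card_neighborSet_eq_degree]
  simp

theorem card_neighborSet_cycleGraph {n : ℕ} (hn : 3 ≤ n) (v : Fin n) :
    Nat.card ((cycleGraph n).neighborSet v) = 2 := by
  obtain ⟨m, rfl⟩ := Nat.exists_eq_add_of_le' hn
  rw [Nat.card_eq_fintype_card, card_neighborSet_eq_degree, cycleGraph_degree_three_le]

/-- In a graph whose components are `K₂`s and cycles, degrees are positive and constant on
components. -/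
theorem IsSachs.exists_degree {H : SimpleGraph V} (hH : IsSachs G H) (K : H.ConnectedComponent) :
    ∃ d, 0 < d ∧ ∀ v ∈ K.supp, (H.neighborSet v).ncard = d := by
  have key : ∀ v (hv : v ∈ K.supp),
      (H.neighborSet v).ncard = Nat.card (K.toSimpleGraph.neighborSet ⟨v, hv⟩) := by
    intro v hv
    let e : K.toSimpleGraph.neighborSet ⟨v, hv⟩ ≃ H.neighborSet v :=
      { toFun := fun w => ⟨w.1.1, w.2⟩
        invFun := fun w => ⟨⟨w.1, K.mem_supp_of_adj_mem_supp hv w.2⟩, w.2⟩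
        left_inv := fun _ => rfl
        right_inv := fun _ => rfl }
    exact (Nat.card_congr e).symm
  rcases hH.2 K with ⟨⟨φ⟩⟩ | ⟨n, hn, ⟨φ⟩⟩
  · refine ⟨1, one_pos, fun v hv => ?_⟩
    rw [key v hv, Nat.card_congr (φ.mapNeighborSet ⟨v, hv⟩), card_neighborSet_completeGraph_two]
  · refine ⟨2, two_pos, fun v hv => ?_⟩
    rw [key v hv, Nat.card_congr (φ.mapNeighborSet ⟨v, hv⟩), card_neighborSet_cycleGraph hn]

/-- If all neighbours of `I` lie in the set `Y`, which is not larger than `I`, then a Sachs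
subgraph has no edge between `Y` and the complement of `I`. -/
theorem IsSachs.mem_of_adj [Finite V] {H : SimpleGraph V} (hH : IsSachs G H) {I Y : Set V}
    (hI : ∀ u ∈ I, ∀ v, H.Adj u v → v ∈ Y) (hcard : Y.ncard ≤ I.ncard) {y v : V} (hy : y ∈ Y)
    (hyv : H.Adj y v) : v ∈ I := by
  classical
  have := Fintype.ofFinite V
  let d : V → ℚ := fun v => ((H.neighborSet v).ncard : ℚ)
  have hd : ∀ v, 0 < d v := by
    intro v
    obtain ⟨n, hn, h⟩ := hH.exists_degree (H.connectedComponentMk v)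
    simp only [d, h v rfl]
    exact_mod_cast hn
  have hdadj : ∀ u v, H.Adj u v → d u = d v := by
    intro u v h
    obtain ⟨n, hn, h'⟩ := hH.exists_degree (H.connectedComponentMk u)
    simp only [d, h' u rfl, h' v (ConnectedComponent.sound h.symm.reachable)]
  -- Degrees agree along edges, so this weight is symmetric, and it sums to one at every vertex.
  let w : V → V → ℚ := fun u v => if H.Adj u v then (d u)⁻¹ else 0
  have hw0 : ∀ u v, 0 ≤ w u v := fun u v => by
    simp only [w]; split_ifs
    · exact (inv_pos.2 (hd u)).le
    · exact le_rfl
  have hwsymm : ∀ u v, w u v = w v u := fun u v => by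
    simp only [w, H.adj_comm v u]
    split_ifs with h
    · rw [hdadj u v h]
    · rfl
  have hsum : ∀ u, ∑ v, w u v = 1 := by
    intro u
    simp only [w]
    rw [← Finset.sum_filter, Finset.sum_const, nsmul_eq_mul]
    have : ((Finset.univ.filter fun v => H.Adj u v).card : ℚ) = d u := by
      simp only [d]
      rw [Set.ncard_eq_toFinset_card']
      congr 2
      ext x; simp
    rw [this, mul_inv_cancel₀ (hd u).ne']
  by_contra hv
  have h1 : (I.ncard : ℚ) = ∑ u ∈ I.toFinset, ∑ z ∈ Y.toFinset, w u z := by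
    rw [Set.ncard_eq_toFinset_card', Finset.card_eq_sum_ones, Nat.cast_sum]
    refine Finset.sum_congr rfl fun u hu => ?_
    rw [Nat.cast_one, ← hsum u]
    symm
    refine Finset.sum_subset (Finset.subset_univ _) fun z _ hz => ?_
    simp only [w]
    rw [if_neg fun h => hz (Set.mem_toFinset.2 (hI u (Set.mem_toFinset.1 hu) z h))]
  have h2 : (Y.ncard : ℚ) = ∑ z ∈ Y.toFinset, ∑ u, w z u := by
    rw [Set.ncard_eq_toFinset_card', Finset.card_eq_sum_ones, Nat.cast_sum]
    exact Finset.sum_congr rfl fun z _ => by rw [hsum z, Nat.cast_one]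
  -- The edge `yv` with `v ∉ I` adds positive weight at `Y` not coming from `I`, forcing `|I| <
  -- |Y|`.
  have h3 : ∑ u ∈ I.toFinset, ∑ z ∈ Y.toFinset, w u z <
      ∑ z ∈ Y.toFinset, ∑ u, w z u := by
    rw [Finset.sum_comm]
    refine Finset.sum_lt_sum (fun z _ => ?_) ⟨y, Set.mem_toFinset.2 hy, ?_⟩
    · rw [Finset.sum_congr rfl fun u _ => hwsymm u z]
      exact Finset.sum_le_sum_of_subset_of_nonneg (Finset.subset_univ _) fun u _ _ => hw0 z u
    · rw [Finset.sum_congr rfl fun u _ => hwsymm u y]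
      refine Finset.sum_lt_sum_of_subset (Finset.subset_univ _) (Finset.mem_univ v)
        (by rwa [Set.mem_toFinset]) ?_ fun u _ _ => hw0 y u
      simp only [if_pos hyv]
      exact inv_pos.2 (hd y)
  rw [← h1, ← h2] at h3
  exact absurd (by exact_mod_cast hcard) (not_le.2 h3)

/-- A Sachs subgraph of a BAB-graph has no edge leaving one of the almost bipartite parts. -/
theorem IsBAB.mem_part_of_adj [Finite V] {k : ℕ} {VB : Set V} {VG : Fin k → Set V}
    (hG : IsBAB G VB VG) {H : SimpleGraph V} (hH : IsSachs G H) {i : Fin k} {u v : V}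
    (hu : u ∈ VG i) (huv : H.Adj u v) : v ∈ VG i := by
  obtain ⟨I, Y, hAY, hIY, hI, hcard⟩ :=
    exists_independent_set (hG.almostBipartite i) (hG.reach i)
  have hbd : ∀ x : VG i, ∀ y, y ∉ VG i → G.Adj x y → x ∈ Y := by
    intro x y hy hxy
    obtain ⟨x', hx', h⟩ := hG.boundary_parts i ⟨x.2, y, hy, hxy⟩
    rw [← Subtype.ext h]
    exact hAY hx'
  by_contra hv
  have huY := hbd ⟨u, hu⟩ v hv (hH.1 huv)
  have := hH.mem_of_adj (I := Subtype.val '' I) (Y := Subtype.val '' Y) (y := u) (v := v)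
    (by
      rintro _ ⟨x, hx, rfl⟩ y hxy
      by_cases hy : y ∈ VG i
      · exact ⟨⟨y, hy⟩, hI x hx ⟨y, hy⟩ (hH.1 hxy), rfl⟩
      · exact absurd (hbd x y hy (hH.1 hxy)) (Set.disjoint_left.1 hIY hx))
    (by rwa [Set.ncard_image_of_injective _ Subtype.val_injective,
      Set.ncard_image_of_injective _ Subtype.val_injective])
    ⟨⟨u, hu⟩, huY, rfl⟩ huv
  obtain ⟨x, -, rfl⟩ := this
  exact hv x.2

end Sachs

end BABGraph

/-- `VB` needs no separate argument: a component meeting some `VG i` cannot leave it, and any other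
component is left with `VB` by the covering condition. -/
theorem mainTheorem2 {V : Type*} [Finite V] (G : SimpleGraph V) (k : ℕ)
    (VB : Set V) (VG : Fin k → Set V) (hG : BABGraph.IsBAB G VB VG)
    (H : SimpleGraph V) (hH : BABGraph.IsSachs G H) (K : H.ConnectedComponent) :
    K.supp ⊆ VB ∨ ∃ i, K.supp ⊆ VG i := by
  have hwalk : ∀ i {u v : V}, H.Walk u v → u ∈ VG i → v ∈ VG i := by
    intro i u v p
    induction p with
    | nil => exact id
    | cons h _ ih => exact fun hu => ih (hG.mem_part_of_adj hH hu h)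
  by_cases h : ∃ i, ∃ u ∈ K.supp, u ∈ VG i
  · obtain ⟨i, u, hu, hui⟩ := h
    refine .inr ⟨i, fun v hv => ?_⟩
    obtain ⟨p⟩ := K.reachable_of_mem_supp hu hv
    exact hwalk i p hui
  · refine .inl fun v hv => ?_
    have hcov : v ∈ VB ∪ ⋃ i, VG i := hG.cover ▸ Set.mem_univ v
    rcases hcov with hvB | hvG
    · exact hvB
    · obtain ⟨i, hi⟩ := Set.mem_iUnion.1 hvG
      exact absurd ⟨i, v, hv, hi⟩ h
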